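/- Let $D\subset\mathbb R^2$ be the closed unit disk and, for $0<\lambda<1/2$, let $\lambda D$ be the closed disk of radius $\lambda$ centred at the origin. Let $\operatorname{Diff}(D,\lambda D)$ be the set of orientation-preserving diffeomorphisms of $D$ onto $\lambda D$ that are smooth, with smooth inverse, up to the boundary. For $\phi\in\operatorname{Diff}(D,\lambda D)$ put $$E_2(\phi)=\frac1\pi\int_D \operatorname{dist}^2\bigl(d\phi_x,\operatorname{SO}_2\bigr)\,dx ,$$ where $\operatorname{dist}$ is the Euclidean (Frobenius) distance on real $2\times2$ matrices, and let $F(s)=1-2s$ for $0\le s\le \frac14$ and $F(s)=2(\sqrt s-1)^2$ for $s\ge\frac14$. Then for every $0<\lambda<\frac12$: 1. $\min_{\phi\in\operatorname{Diff}(D,\lambda D)}E_2(\phi)=F(\lambda^2)$; in particular the minimum is attained. 2. There is an infinite-dimensional family of minimizers, in the following sense. There is a convex set $C$ of functions $\psi:[0,1]\to[0,\lambda]$, for which the real vector space spanned by the differences $\psi_1-\psi_2$ ($\psi_1,\psi_2\in C$) is infinite-dimensional, such that every $\psi\in C$ is smooth, concave and strictly increasing with $\psi(0)=0$, $\psi(1)=\lambda$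 and $\psi(r)=r/2$ for all $r$ near $0$, and such that for every $\psi\in C$ there is a smooth non-decreasing function $h:[0,1]\to\mathbb R$ with $h(0)=0$ that solves the ordinary differential equation $$\Bigl(\psi'(r)+\frac{\psi(r)}r\Bigr)^2+\bigl(h'(r)\psi(r)\bigr)^2=1\qquad(0<r\le1)$$ and for which the map given in polar coordinates by $(r,\theta)\mapsto(\psi(r),\theta+h(r))$ belongs to $\operatorname{Diff}(D,\lambda D)$ and has energy $E_2=F(\lambda^2)$. -/

import Mathlib

open Set MeasureTheory
open scoped ContDiff

noncomputable section

namespace DiskMap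

/-- The Euclidean plane. -/
abbrev Plane : Type := EuclideanSpace ℝ (Fin 2)

/-- The closed disk of radius `r` centred at the origin. -/
def disk (r : ℝ) : Set Plane := Metric.closedBall 0 r

/-- The Jacobian matrix, in the standard basis, of a map on `s` (one-sided derivatives are used at
boundary points of `s`, so only the values of `φ` on `s` matter). -/
def jac (s : Set Plane) (φ : Plane → Plane) (x : Plane) : Matrix (Fin 2) (Fin 2) ℝ :=
  Matrix.of fun i j => fderivWithin ℝ φ s x (EuclideanSpace.single j 1) i

/-- The Euclidean (Frobenius) distance of a real `2 × 2` matrix from `SO₂`. -/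
def distSO2 (A : Matrix (Fin 2) (Fin 2) ℝ) : ℝ :=
  ⨅ R : Matrix.specialOrthogonalGroup (Fin 2) ℝ,
    Real.sqrt (∑ i, ∑ j, (A i j - (R : Matrix (Fin 2) (Fin 2) ℝ) i j) ^ 2)

/-- The energy `E₂`: the average over `s` of the squared distance of the differential
from `SO₂`. -/
def energy (s : Set Plane) (φ : Plane → Plane) : ℝ :=
  ⨍ x in s, distSO2 (jac s φ x) ^ 2

/-- The lower-bound function `F` on `[0, ∞)`. -/
def F (t : ℝ) : ℝ :=
  if t ≤ 1 / 4 then 1 - 2 * t else 2 * (Real.sqrt t - 1) ^ 2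

/-- Orientation-preserving smooth diffeomorphisms (up to the boundary) from `s` onto `t`; maps are
represented by functions on the plane of which only the values on `s` matter. -/
def Diff (s t : Set Plane) : Set (Plane → Plane) :=
  {φ | ContDiffOn ℝ ∞ φ s ∧ BijOn φ s t ∧
    (∃ χ : Plane → Plane, ContDiffOn ℝ ∞ χ t ∧ InvOn χ φ s t) ∧
    ∀ x ∈ s, 0 < (jac s φ x).det}

/-- On the unit disk, `φ` is `(r, θ) ↦ (ψ r, θ + h r)` in polar coordinates. -/
def HasPolarForm (φ : Plane → Plane) (ψ h : ℝ → ℝ) : Prop :=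
  ∀ r ∈ Icc (0 : ℝ) 1, ∀ θ : ℝ,
    φ !₂[r * Real.cos θ, r * Real.sin θ] =
      !₂[ψ r * Real.cos (θ + h r), ψ r * Real.sin (θ + h r)]

/-- Radial profiles `ψ : [0, 1] → [0, lam]`: smooth, concave, strictly increasing, onto, and equal to
`r / 2` near `r = 0`. -/
structure IsProfile (lam : ℝ) (ψ : ℝ → ℝ) : Prop where
  smooth : ContDiffOn ℝ ∞ ψ (Icc 0 1)
  concave : ConcaveOn ℝ (Icc 0 1) ψ
  strictMono : StrictMonoOn ψ (Icc 0 1)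
  map_zero : ψ 0 = 0
  map_one : ψ 1 = lam
  linear_near_zero : ∃ ε ∈ Ioc (0 : ℝ) 1, ∀ r ∈ Icc 0 ε, ψ r = r / 2

/-- The ordinary differential equation `(ψ' + ψ / r)² + (h' ψ)² = 1` on `(0, 1]`. -/
def SolvesODE (ψ h : ℝ → ℝ) : Prop :=
  ∀ r ∈ Ioc (0 : ℝ) 1,
    (derivWithin ψ (Icc 0 1) r + ψ r / r) ^ 2 + (derivWithin h (Icc 0 1) r * ψ r) ^ 2 = 1

/-- A set of functions, compared on `[0, 1]` only, is infinite-dimensional if the real vector space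
spanned by the differences of the restrictions of its members to `[0, 1]` is so. -/
def InfiniteDimensionalOnIcc (C : Set (ℝ → ℝ)) : Prop :=
  ¬ FiniteDimensional ℝ (vectorSpan ℝ ((Icc (0 : ℝ) 1).domRestrict '' C))

end DiskMap

end

/-! Write κ(A) for the conformal part of a 2 × 2 matrix A. Then dist²(A, SO₂) = (κ(A) - 1)² + 1 - 2
det A (`distSO2_sq`). The determinant is a null Lagrangian: over D it integrates to the area πλ² of
the image. So E₂ is 1 - 2λ² plus the mean of (κ - 1)², and 1 - 2λ² = F(λ²) because λ < 1/2. The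
bound follows, and it is attained by any map with κ = 1 everywhere.

For (r, θ) ↦ (ψ r, θ + h r) one finds κ² = (ψ' + ψ/r)² + (h'ψ)² (`jac_twist`), so the differential
equation says exactly κ = 1. It can be solved for h' once the defect 1 - ψ' - ψ/r is nonnegative,
which concavity and ψ = r/2 near 0 ensure.

The difficulty is the smoothness of h', a square root, at the radius a where the defect leaves 0. An
explicit profile is used there, whose defect near a is the square of a smooth function times a
positive smooth one (`defect_eq_of_lt`). Beyond some c > a the profile is strictly concave and can
be perturbed by any small bump, which gives the infinite-dimensional family. -/

namespace DiskMap

/-! ### Squared distance to the rotation group -/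

/-- The conformal part `√((a + d)² + (c - b)²)` of the matrix with rows `(a, b)` and `(c, d)`. -/
noncomputable def conformalPart (A : Matrix (Fin 2) (Fin 2) ℝ) : ℝ :=
  Real.sqrt ((A 0 0 + A 1 1) ^ 2 + (A 1 0 - A 0 1) ^ 2)

/-- Expanding gives |A|² - 2⟨A, R⟩ + 2 with |A|² = κ² - 2 det A, and ⟨A, R⟩ ≤ κ by Cauchy–Schwarz,
since R is given by a unit vector. -/
theorem sum_sq_sub_rotation_ge (A : Matrix (Fin 2) (Fin 2) ℝ)
    (R : Matrix.specialOrthogonalGroup (Fin 2) ℝ) :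
    (conformalPart A - 1) ^ 2 + 1 - 2 * A.det ≤
      ∑ i, ∑ j, (A i j - (R : Matrix (Fin 2) (Fin 2) ℝ) i j) ^ 2 := by
  obtain ⟨R, hR⟩ := R
  rw [Matrix.mem_specialOrthogonalGroup_iff, Matrix.mem_orthogonalGroup_iff] at hR
  obtain ⟨h1, h2⟩ := hR
  have h00 := congrFun (congrFun h1 0) 0
  have h01 := congrFun (congrFun h1 0) 1
  have h11 := congrFun (congrFun h1 1) 1
  simp [Matrix.mul_apply, Fin.sum_univ_two] at h00 h01 h11
  rw [Matrix.det_fin_two] at h2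
  have e1 : R 1 1 = R 0 0 := by
    linear_combination R 0 0 * h2 + R 0 1 * h01 - R 1 1 * h00
  have e2 : R 1 0 = - R 0 1 := by
    linear_combination (-R 0 1) * h2 + R 0 0 * h01 - R 1 0 * h00
  have hsq := Real.sq_sqrt (show 0 ≤ (A 0 0 + A 1 1) ^ 2 + (A 1 0 - A 0 1) ^ 2 by positivity)
  have hcs : (A 0 0 + A 1 1) * R 0 0 - (A 1 0 - A 0 1) * R 0 1 ≤ conformalPart A := by
    apply Real.le_sqrt_of_sq_le
    have h3 : R 0 0 ^ 2 + R 0 1 ^ 2 = 1 := by linear_combination h00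
    nlinarith [sq_nonneg ((A 0 0 + A 1 1) * R 0 1 + (A 1 0 - A 0 1) * R 0 0)]
  change conformalPart A ^ 2 = _ at hsq
  simp only [Fin.sum_univ_two, Matrix.det_fin_two, e1, e2]
  nlinarith

theorem exists_rotation_sum_sq_sub_eq (A : Matrix (Fin 2) (Fin 2) ℝ) :
    ∃ R : Matrix.specialOrthogonalGroup (Fin 2) ℝ,
      ∑ i, ∑ j, (A i j - (R : Matrix (Fin 2) (Fin 2) ℝ) i j) ^ 2 =
        (conformalPart A - 1) ^ 2 + 1 - 2 * A.det := by
  have hsq := Real.sq_sqrt (show 0 ≤ (A 0 0 + A 1 1) ^ 2 + (A 1 0 - A 0 1) ^ 2 by positivity)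
  change conformalPart A ^ 2 = _ at hsq
  obtain ⟨c, s, h1, h2, h3⟩ : ∃ c s : ℝ, c ^ 2 + s ^ 2 = 1 ∧
      A 0 0 + A 1 1 = conformalPart A * c ∧ A 1 0 - A 0 1 = conformalPart A * s := by
    -- The optimal rotation points along (a + d, c - b); if that vector is zero, every rotation is
    -- optimal.
    by_cases h : conformalPart A = 0
    · refine ⟨1, 0, by norm_num, ?_, ?_⟩ <;> rw [h] at hsq ⊢ <;> nlinarith
    · refine ⟨(A 0 0 + A 1 1) / conformalPart A, (A 1 0 - A 0 1) / conformalPart A, ?_, ?_, ?_⟩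
      · field_simp; linarith
      · field_simp
      · field_simp
  have hR : !![c, -s; s, c] ∈ Matrix.specialOrthogonalGroup (Fin 2) ℝ := by
    rw [Matrix.mem_specialOrthogonalGroup_iff, Matrix.mem_orthogonalGroup_iff]
    constructor
    · ext i j
      fin_cases i <;> fin_cases j <;> simp [Matrix.mul_apply, Fin.sum_univ_two] <;>
        linarith
    · rw [Matrix.det_fin_two]; simp; linarith
  refine ⟨⟨_, hR⟩, ?_⟩
  simp only [Fin.sum_univ_two, Matrix.det_fin_two]
  simp
  linear_combination -hsq + 2 * h1 - 2 * c * h2 - 2 * s * h3 - 2 * conformalPart A * h1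

theorem distSO2_sq (A : Matrix (Fin 2) (Fin 2) ℝ) :
    distSO2 A ^ 2 = (conformalPart A - 1) ^ 2 + 1 - 2 * A.det := by
  obtain ⟨R, hR⟩ := exists_rotation_sum_sq_sub_eq A
  have : distSO2 A = Real.sqrt ((conformalPart A - 1) ^ 2 + 1 - 2 * A.det) := by
    have : Nonempty (Matrix.specialOrthogonalGroup (Fin 2) ℝ) := ⟨R⟩
    refine le_antisymm ?_ (le_ciInf fun R => Real.sqrt_le_sqrt (sum_sq_sub_rotation_ge A R))
    rw [← hR]
    exact ciInf_le ⟨0, by rintro _ ⟨S, rfl⟩; positivity⟩ R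
  rw [this, Real.sq_sqrt (by rw [← hR]; positivity)]

/-! ### The energy as a constant plus a nonnegative integral -/

theorem det_jac (s : Set Plane) (φ : Plane → Plane) (x : Plane) :
    (jac s φ x).det = (fderivWithin ℝ φ s x).det := by
  rw [ContinuousLinearMap.det, ← LinearMap.det_toMatrix (EuclideanSpace.basisFun (Fin 2) ℝ).toBasis]
  congr 1

theorem uniqueDiffOn_disk : UniqueDiffOn ℝ (disk 1) :=
  uniqueDiffOn_convex (show Convex ℝ (disk 1) from convex_closedBall (0 : Plane) 1)
    (by rw [disk, interior_closedBall _ one_ne_zero]; exact ⟨0, by simp⟩)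

theorem continuousOn_jac {φ : Plane → Plane} (hφ : ContDiffOn ℝ ∞ φ (disk 1)) (i j : Fin 2) :
    ContinuousOn (fun x => jac (disk 1) φ x i j) (disk 1) := by
  have h := hφ.continuousOn_fderivWithin uniqueDiffOn_disk (by simp)
  have h2 : ContinuousOn (fun x => fderivWithin ℝ φ (disk 1) x (EuclideanSpace.single j 1))
    (disk 1) := h.clm_apply continuousOn_const
  exact (EuclideanSpace.proj (𝕜 := ℝ) i).continuous.comp_continuousOn h2

theorem continuousOn_det_jac {φ : Plane → Plane} (hφ : ContDiffOn ℝ ∞ φ (disk 1)) :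
    ContinuousOn (fun x => (jac (disk 1) φ x).det) (disk 1) := by
  simp only [Matrix.det_fin_two]
  exact ((continuousOn_jac hφ 0 0).mul (continuousOn_jac hφ 1 1)).sub
    ((continuousOn_jac hφ 0 1).mul (continuousOn_jac hφ 1 0))

theorem continuousOn_conformalPart_jac {φ : Plane → Plane} (hφ : ContDiffOn ℝ ∞ φ (disk 1)) :
    ContinuousOn (fun x => conformalPart (jac (disk 1) φ x)) (disk 1) :=
  ((((continuousOn_jac hφ 0 0).add (continuousOn_jac hφ 1 1)).pow 2).add
    (((continuousOn_jac hφ 1 0).sub (continuousOn_jac hφ 0 1)).pow 2)).sqrt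

theorem isCompact_disk (r : ℝ) : IsCompact (disk r) := isCompact_closedBall _ _

theorem volume_disk {r : ℝ} (hr : 0 ≤ r) : volume.real (disk r) = Real.pi * r ^ 2 := by
  rw [disk, Measure.real, EuclideanSpace.volume_closedBall_fin_two]
  simp [hr, mul_comm, Real.pi_pos.le]

/-- Change of variables for an injective map; positivity of the determinant removes the absolute
value. -/
theorem integral_det_jac {φ : Plane → Plane} {lam : ℝ} (hlam : 0 ≤ lam)
    (hφ : φ ∈ Diff (disk 1) (disk lam)) :
    ∫ x in disk 1, (jac (disk 1) φ x).det = Real.pi * lam ^ 2 := by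
  obtain ⟨hs, hb, -, hpos⟩ := hφ
  have hms : MeasurableSet (disk 1) := Metric.isClosed_closedBall.measurableSet
  have h1 := lintegral_abs_det_fderiv_eq_addHaar_image volume hms
    (fun x hx => ((hs.differentiableOn (by simp)) x hx).hasFDerivWithinAt) hb.injOn
  rw [hb.image_eq] at h1
  rw [← volume_disk hlam, Measure.real, ← h1,
    integral_eq_lintegral_of_nonneg_ae]
  · congr 1
    refine setLIntegral_congr_fun hms fun x hx => ?_
    rw [← det_jac, abs_of_pos (hpos x hx)]
  · exact (ae_restrict_mem hms).mono fun x hx => (hpos x hx).le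
  · exact (continuousOn_det_jac hs).aestronglyMeasurable hms

theorem energy_eq {φ : Plane → Plane} {lam : ℝ} (hlam : 0 ≤ lam)
    (hφ : φ ∈ Diff (disk 1) (disk lam)) :
    energy (disk 1) φ = (1 - 2 * lam ^ 2) +
      Real.pi⁻¹ * ∫ x in disk 1, (conformalPart (jac (disk 1) φ x) - 1) ^ 2 := by
  have hi1 : IntegrableOn (fun x => (conformalPart (jac (disk 1) φ x) - 1) ^ 2) (disk 1) :=
    (((continuousOn_conformalPart_jac hφ.1).sub continuousOn_const).pow 2).integrableOn_compact
      (isCompact_disk 1)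
  have hi2 : IntegrableOn (fun x => (jac (disk 1) φ x).det) (disk 1) :=
    (continuousOn_det_jac hφ.1).integrableOn_compact (isCompact_disk 1)
  have hi3 : IntegrableOn (fun _ : Plane => (1 : ℝ)) (disk 1) :=
    continuousOn_const.integrableOn_compact (isCompact_disk 1)
  have hv := volume_disk zero_le_one
  rw [energy, setAverage_eq, hv]
  simp only [distSO2_sq]
  have h1 := integral_sub (hi1.add hi3) (hi2.const_mul 2)
  have h2 := integral_add hi1 hi3
  simp only [Pi.add_apply] at h1 h2
  rw [h1, h2, integral_const_mul,
    integral_det_jac hlam hφ, setIntegral_const, hv, smul_eq_mul, smul_eq_mul]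
  field_simp
  ring

theorem energy_ge {φ : Plane → Plane} {lam : ℝ} (hlam : 0 ≤ lam)
    (hφ : φ ∈ Diff (disk 1) (disk lam)) : 1 - 2 * lam ^ 2 ≤ energy (disk 1) φ := by
  rw [energy_eq hlam hφ]
  have : 0 ≤ ∫ x in disk 1, (conformalPart (jac (disk 1) φ x) - 1) ^ 2 :=
    integral_nonneg fun x => sq_nonneg _
  have := Real.pi_pos
  linarith [show 0 ≤ Real.pi⁻¹ * ∫ x in disk 1, (conformalPart (jac (disk 1) φ x) - 1) ^ 2 by
    positivity]

theorem energy_eq_of_conformalPart_eq_one {φ : Plane → Plane} {lam : ℝ} (hlam : 0 ≤ lam)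
    (hφ : φ ∈ Diff (disk 1) (disk lam))
    (h : ∀ x ∈ disk 1, conformalPart (jac (disk 1) φ x) = 1) :
    energy (disk 1) φ = 1 - 2 * lam ^ 2 := by
  have hms : MeasurableSet (disk 1) := Metric.isClosed_closedBall.measurableSet
  rw [energy_eq hlam hφ, setIntegral_congr_fun hms (g := fun _ => 0) fun x hx => by simp [h x hx]]
  simp


/-! ### Twist maps: smoothness, Jacobian, inverse -/

/-- The map `(r, θ) ↦ (ψ r, θ + h r)` of the plane in polar coordinates. -/
noncomputable def twist (ψ h : ℝ → ℝ) (x : Plane) : Plane :=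
  !₂[ψ ‖x‖ / ‖x‖ * (Real.cos (h ‖x‖) * x 0 - Real.sin (h ‖x‖) * x 1),
    ψ ‖x‖ / ‖x‖ * (Real.sin (h ‖x‖) * x 0 + Real.cos (h ‖x‖) * x 1)]

theorem norm_sq_plane (x : Plane) : ‖x‖ ^ 2 = x 0 ^ 2 + x 1 ^ 2 := by
  simp [EuclideanSpace.norm_sq_eq]

theorem twist_zero (ψ h : ℝ → ℝ) : twist ψ h 0 = 0 := by
  ext i; fin_cases i <;> simp [twist]

theorem norm_twist {ψ : ℝ → ℝ} (h : ℝ → ℝ) {x : Plane} (h0 : ψ 0 = 0) (hx : 0 ≤ ψ ‖x‖) :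
    ‖twist ψ h x‖ = ψ ‖x‖ := by
  by_cases hx0 : x = 0
  · simp [hx0, twist_zero, h0]
  have hr : ‖x‖ ≠ 0 := by simpa using hx0
  rw [← sq_eq_sq₀ (norm_nonneg _) hx, norm_sq_plane]
  have h1 := norm_sq_plane x
  have h2 := Real.sin_sq_add_cos_sq (h ‖x‖)
  simp only [twist, PiLp.toLp_apply, Matrix.cons_val_zero, Matrix.cons_val_one]
  field_simp
  linear_combination ψ ‖x‖ ^ 2 * ((x 0 ^ 2 + x 1 ^ 2) * h2 - h1)

theorem twist_twist {ψ h σ k : ℝ → ℝ} {x : Plane} (h0 : ψ 0 = 0) (hx : 0 ≤ ψ ‖x‖)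
    (hx' : ψ ‖x‖ = 0 → ‖x‖ = 0) (hσ : σ (ψ ‖x‖) = ‖x‖) (hk : k (ψ ‖x‖) = - h ‖x‖) :
    twist σ k (twist ψ h x) = x := by
  by_cases hx0 : x = 0
  · simp [hx0, twist_zero]
  have hr : ‖x‖ ≠ 0 := by simpa using hx0
  have hp : ψ ‖x‖ ≠ 0 := fun h => hr (hx' h)
  have h2 := Real.sin_sq_add_cos_sq (h ‖x‖)
  rw [twist, norm_twist h h0 hx, hσ, hk, Real.cos_neg, Real.sin_neg]
  ext i
  fin_cases i <;>
    simp only [twist, PiLp.toLp_apply, Matrix.cons_val_zero, Matrix.cons_val_one, Fin.mk_one,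
      Fin.zero_eta]
  · field_simp
    linear_combination x 0 * h2
  · field_simp
    linear_combination x 1 * h2

theorem twist_eq_smul {ψ h : ℝ → ℝ} {x : Plane} {κ : ℝ} (hψ : ψ ‖x‖ = κ * ‖x‖) (hh : h ‖x‖ = 0) :
    twist ψ h x = κ • x := by
  by_cases hx0 : x = 0
  · simp [hx0, twist_zero]
  have hr : ‖x‖ ≠ 0 := by simpa using hx0
  ext i
  fin_cases i <;> simp [twist, hψ, hh, hr]

theorem contDiffAt_coord (i : Fin 2) (x : Plane) : ContDiffAt ℝ ∞ (fun x : Plane => x i) x :=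
  (EuclideanSpace.proj (𝕜 := ℝ) i).contDiff.contDiffAt

theorem contDiffAt_twist {ψ h : ℝ → ℝ} {x : Plane} (hx : x ≠ 0) (hψ : ContDiffAt ℝ ∞ ψ ‖x‖)
    (hh : ContDiffAt ℝ ∞ h ‖x‖) : ContDiffAt ℝ ∞ (twist ψ h) x := by
  have hn : ContDiffAt ℝ ∞ (fun x : Plane => ‖x‖) x := contDiffAt_norm ℝ hx
  have hψ' : ContDiffAt ℝ ∞ (fun x : Plane => ψ ‖x‖) x := hψ.comp x hn
  have hh' : ContDiffAt ℝ ∞ (fun x : Plane => h ‖x‖) x := hh.comp x hn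
  have hq := hψ'.div hn (by simpa using hx)
  rw [contDiffAt_euclidean]
  intro i
  fin_cases i
  · exact hq.mul ((hh'.cos.mul (contDiffAt_coord 0 x)).sub (hh'.sin.mul (contDiffAt_coord 1 x)))
  · exact hq.mul ((hh'.sin.mul (contDiffAt_coord 0 x)).add (hh'.cos.mul (contDiffAt_coord 1 x)))

theorem twist_eventuallyEq_smul {ψ h : ℝ → ℝ} {a κ : ℝ} (hψ : ∀ r < a, ψ r = κ * r)
    (hh : ∀ r < a, h r = 0) {x : Plane} (hx : ‖x‖ < a) :
    twist ψ h =ᶠ[nhds x] fun y => κ • y := by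
  filter_upwards [continuous_norm.continuousAt.eventually_lt continuousAt_const hx] with y hy
  exact twist_eq_smul (hψ _ hy) (hh _ hy)

/-- The norm is not smooth at the origin, but there the twist coincides with a homothety. -/
theorem contDiffAt_twist_of_linear {ψ h : ℝ → ℝ} {a κ : ℝ} (ha : 0 < a)
    (hψ : ∀ r < a, ψ r = κ * r) (hh : ∀ r < a, h r = 0) {x : Plane}
    (hψx : ContDiffAt ℝ ∞ ψ ‖x‖) (hhx : ContDiffAt ℝ ∞ h ‖x‖) :
    ContDiffAt ℝ ∞ (twist ψ h) x := by
  by_cases hx : x = 0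
  · have : ContDiffAt ℝ ∞ (fun y : Plane => κ • y) x := by fun_prop
    exact this.congr_of_eventuallyEq (twist_eventuallyEq_smul hψ hh (by simpa [hx] using ha))
  · exact contDiffAt_twist hx hψx hhx

/-- The partial derivatives come from differentiating ‖y‖² in two ways. -/
theorem hasFDerivAt_norm_plane {x : Plane} (hx : x ≠ 0) :
    ∃ N : Plane →L[ℝ] ℝ, HasFDerivAt (fun y : Plane => ‖y‖) N x ∧
      ∀ j, N (EuclideanSpace.single j 1) = x j / ‖x‖ := by
  have hn := ((contDiffAt_norm ℝ (n := 1) hx).differentiableAt one_ne_zero).hasFDerivAt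
  refine ⟨_, hn, fun j => ?_⟩
  have h2 := hn.pow 2
  have h3 := h2.unique (hasStrictFDerivAt_norm_sq x).hasFDerivAt
  have h4 := congrArg (fun L : Plane →L[ℝ] ℝ => L (EuclideanSpace.single j 1)) h3
  have hr : ‖x‖ ≠ 0 := by simpa using hx
  simp [EuclideanSpace.inner_single_right] at h4
  field_simp
  linarith

theorem jac_apply {f : Plane → Plane} {x : Plane} (hx : x ∈ disk 1) (hf : DifferentiableAt ℝ f x)
    {i : Fin 2} {L : Plane →L[ℝ] ℝ} (hL : HasFDerivAt (fun y => f y i) L x) (j : Fin 2) :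
    jac (disk 1) f x i j = L (EuclideanSpace.single j 1) := by
  have h1 := (EuclideanSpace.proj (𝕜 := ℝ) i).hasFDerivAt.comp x hf.hasFDerivAt
  rw [← h1.unique hL]
  simp [jac, hf.fderivWithin (uniqueDiffOn_disk x hx)]

theorem jac_eq_of_eventuallyEq_smul {f : Plane → Plane} {x : Plane} {κ : ℝ} (hx : x ∈ disk 1)
    (hf : f =ᶠ[nhds x] fun y => κ • y) : jac (disk 1) f x = Matrix.diagonal fun _ => κ := by
  have h1 : HasFDerivAt f (κ • ContinuousLinearMap.id ℝ Plane) x :=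
    ((hasFDerivAt_id x).const_smul κ).congr_of_eventuallyEq hf
  ext i j
  rw [jac, h1.hasFDerivWithinAt.fderivWithin (uniqueDiffOn_disk x hx)]
  fin_cases i <;> fin_cases j <;> simp

theorem jac_twist {ψ h : ℝ → ℝ} {x : Plane} {p q : ℝ} (hx1 : x ∈ disk 1) (hx : x ≠ 0)
    (hd : DifferentiableAt ℝ (twist ψ h) x)
    (hψ : HasDerivAt ψ p ‖x‖) (hh : HasDerivAt h q ‖x‖) :
    (jac (disk 1) (twist ψ h) x).det = ψ ‖x‖ / ‖x‖ * p ∧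
      conformalPart (jac (disk 1) (twist ψ h) x) =
        Real.sqrt ((p + ψ ‖x‖ / ‖x‖) ^ 2 + (q * ψ ‖x‖) ^ 2) := by
  obtain ⟨N, hN, hNj⟩ := hasFDerivAt_norm_plane hx
  have hr : ‖x‖ ≠ 0 := by simpa using hx
  have hψ' : HasFDerivAt (fun y : Plane => ψ ‖y‖ / ‖y‖) _ x :=
    (hψ.div (hasDerivAt_id ‖x‖) hr).comp_hasFDerivAt x hN
  have hc : HasFDerivAt (fun y : Plane => Real.cos (h ‖y‖)) _ x :=
    hh.cos.comp_hasFDerivAt x hN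
  have hs : HasFDerivAt (fun y : Plane => Real.sin (h ‖y‖)) _ x :=
    hh.sin.comp_hasFDerivAt x hN
  have hco (i : Fin 2) : HasFDerivAt (fun y : Plane => y i) _ x :=
    (EuclideanSpace.proj (𝕜 := ℝ) i).hasFDerivAt
  have h0 := jac_apply (i := 0) hx1 hd (hψ'.mul ((hc.mul (hco 0)).sub (hs.mul (hco 1))))
  have h1 := jac_apply (i := 1) hx1 hd (hψ'.mul ((hs.mul (hco 0)).add (hc.mul (hco 1))))
  have hsq := norm_sq_plane x
  have hsc := Real.sin_sq_add_cos_sq (h ‖x‖)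
  have h00 := h0 0
  have h01 := h0 1
  have h10 := h1 0
  have h11 := h1 1
  simp [hNj] at h00 h01 h10 h11
  generalize Real.sin (h ‖x‖) = s at *
  generalize Real.cos (h ‖x‖) = c at *
  generalize ψ ‖x‖ = P at *
  generalize ‖x‖ = r at *
  obtain ⟨m, rfl⟩ : ∃ m, P = m * r := ⟨P / r, by field_simp⟩
  obtain ⟨u, hu⟩ : ∃ u, x 0 = u * r := ⟨x 0 / r, by field_simp⟩
  obtain ⟨v, hv⟩ : ∃ v, x 1 = v * r := ⟨x 1 / r, by field_simp⟩
  have huv : u ^ 2 + v ^ 2 = 1 := by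
    have : r ^ 2 * (u ^ 2 + v ^ 2) = r ^ 2 * 1 := by rw [hu, hv] at hsq; linarith
    exact mul_left_cancel₀ (pow_ne_zero 2 hr) this
  rw [hu, hv] at h00 h01 h10 h11
  -- With e = (u, v) = x/r, e⊥ = (-v, u) and m = ψ/r, the Jacobian is the rotation by h times m I +
  -- (p - m) e eᵀ + m r q e⊥ eᵀ. In the frame (e, e⊥) the second factor is triangular with diagonal
  -- p, m and off-diagonal entry m r q.
  have k00 : jac (disk 1) (twist ψ h) x 0 0 =
      c * (m + (p - m) * u ^ 2 - m * r * q * u * v) -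
        s * ((p - m) * u * v + m * r * q * u ^ 2) := by
    rw [h00]; field_simp; ring
  have k10 : jac (disk 1) (twist ψ h) x 1 0 =
      s * (m + (p - m) * u ^ 2 - m * r * q * u * v) +
        c * ((p - m) * u * v + m * r * q * u ^ 2) := by
    rw [h10]; field_simp; ring
  have k01 : jac (disk 1) (twist ψ h) x 0 1 =
      c * ((p - m) * u * v - m * r * q * v ^ 2) -
        s * (m + (p - m) * v ^ 2 + m * r * q * u * v) := by
    rw [h01]; field_simp; ring
  have k11 : jac (disk 1) (twist ψ h) x 1 1 =
      s * ((p - m) * u * v - m * r * q * v ^ 2) +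
        c * (m + (p - m) * v ^ 2 + m * r * q * u * v) := by
    rw [h11]; field_simp; ring
  rw [mul_div_cancel_right₀ m hr]
  constructor
  · rw [Matrix.det_fin_two, k00, k01, k10, k11]
    linear_combination (m ^ 2 + m * (p - m) * (u ^ 2 + v ^ 2)) * hsc + m * (p - m) * huv
  · have ht : jac (disk 1) (twist ψ h) x 0 0 + jac (disk 1) (twist ψ h) x 1 1 =
        c * (p + m) - s * (m * r * q) := by
      rw [k00, k11]
      linear_combination (c * (p - m) - s * m * r * q) * huv
    have hw : jac (disk 1) (twist ψ h) x 1 0 - jac (disk 1) (twist ψ h) x 0 1 =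
        s * (p + m) + c * (m * r * q) := by
      rw [k10, k01]
      linear_combination (s * (p - m) + c * m * r * q) * huv
    rw [conformalPart, ht, hw]
    congr 1
    linear_combination ((p + m) ^ 2 + (m * r * q) ^ 2) * hsc

/-- A left inverse of a smooth function with nonvanishing derivative is smooth
at the values of the function. -/
theorem contDiffAt_leftInverse {ψ σ : ℝ → ℝ} {r : ℝ} (hψ : ContDiff ℝ ∞ ψ)
    (hd : deriv ψ r ≠ 0) (hσ : Function.LeftInverse σ ψ) : ContDiffAt ℝ ∞ σ (ψ r) := by
  have h1 : HasFDerivAt ψ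
      ((ContinuousLinearEquiv.unitsEquivAut ℝ (Units.mk0 _ hd) : ℝ ≃L[ℝ] ℝ) : ℝ →L[ℝ] ℝ) r :=
    (hψ.differentiable (by simp) r).hasDerivAt.hasFDerivAt_equiv hd
  have h2 := hψ.contDiffAt.to_localInverse h1 (by simp)
  -- Near ψ r the local inverse of the inverse function theorem is also a right inverse of ψ, so the
  -- global left inverse σ agrees with it.
  refine h2.congr_of_eventuallyEq ?_
  filter_upwards [(hψ.contDiffAt.hasStrictFDerivAt' h1 (by simp)).eventually_right_inverse]
    with y hy
  conv_lhs => rw [← hy]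
  exact hσ _

/-- A smooth radial profile, linear near the origin, with a smooth twist that vanishes near the
origin, gives a diffeomorphism of the unit disk onto the disk of radius `ψ 1`. -/
theorem twist_mem_diff {ψ h : ℝ → ℝ} {a κ : ℝ} (ha : 0 < a) (hκ : 0 < κ)
    (hψ : ContDiff ℝ ∞ ψ) (hh : ContDiff ℝ ∞ h) (hd : ∀ r, 0 < deriv ψ r)
    (hlin : ∀ r < a, ψ r = κ * r) (hh0 : ∀ r < a, h r = 0) :
    twist ψ h ∈ Diff (disk 1) (disk (ψ 1)) := by
  have hmono : StrictMono ψ := strictMono_of_deriv_pos hd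
  have h0 : ψ 0 = 0 := by simpa using hlin 0 ha
  have hnn {r : ℝ} (hr : 0 ≤ r) : 0 ≤ ψ r := h0 ▸ hmono.monotone hr
  have hz {r : ℝ} (hr : ψ r = 0) : r = 0 := hmono.injective (hr.trans h0.symm)
  -- The inverse map is again a twist, with profile σ and angle -h ∘ σ; these are linear and zero
  -- near 0, so it is smooth at the origin too.
  let σ := Function.invFun ψ
  have hσ : Function.LeftInverse σ ψ := Function.leftInverse_invFun hmono.injective
  have hsmooth (x : Plane) : ContDiffAt ℝ ∞ (twist ψ h) x :=
    contDiffAt_twist_of_linear ha hlin hh0 hψ.contDiffAt hh.contDiffAt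
  have hrange {y : ℝ} (hy : y ∈ Icc 0 (ψ 1)) : ∃ r ∈ Icc (0 : ℝ) 1, ψ r = y := by
    rw [← h0] at hy
    exact intermediate_value_Icc zero_le_one hψ.continuous.continuousOn hy
  have hσlin (s : ℝ) (hs : s < κ * a) : σ s = κ⁻¹ * s := by
    have : ψ (κ⁻¹ * s) = s := by
      rw [hlin _ (by rwa [inv_mul_lt_iff₀ hκ])]; field_simp
    rw [← this, hσ, this]
  have hk0 (s : ℝ) (hs : s < κ * a) : - h (σ s) = 0 := by
    rw [hσlin s hs, hh0 _ (by rwa [inv_mul_lt_iff₀ hκ]), neg_zero]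
  have hmaps : MapsTo (twist ψ h) (disk 1) (disk (ψ 1)) := by
    intro x hx
    rw [disk, mem_closedBall_zero_iff] at hx ⊢
    rw [norm_twist h h0 (hnn (norm_nonneg x))]
    exact hmono.monotone hx
  have hinv {y : Plane} (hy : y ∈ disk (ψ 1)) : ∃ r ∈ Icc (0 : ℝ) 1, ψ r = ‖y‖ ∧ σ ‖y‖ = r := by
    rw [disk, mem_closedBall_zero_iff] at hy
    obtain ⟨r, hr, hry⟩ := hrange ⟨norm_nonneg y, hy⟩
    exact ⟨r, hr, hry, by rw [← hry, hσ]⟩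
  have hσ0 : σ 0 = 0 := by simpa [h0] using hσ 0
  have hmaps' : MapsTo (twist σ fun s => - h (σ s)) (disk (ψ 1)) (disk 1) := by
    intro y hy
    obtain ⟨r, hr, hry, hσr⟩ := hinv hy
    rw [disk, mem_closedBall_zero_iff, norm_twist _ hσ0 (hσr ▸ hr.1), hσr]
    exact hr.2
  have hinvOn : InvOn (twist σ fun s => - h (σ s)) (twist ψ h) (disk 1) (disk (ψ 1)) := by
    constructor
    · intro x _
      refine twist_twist h0 (hnn (norm_nonneg x)) hz (hσ _) ?_
      simp only [hσ ‖x‖]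
    · intro y hy
      obtain ⟨r, hr, hry, hσr⟩ := hinv hy
      refine twist_twist hσ0 (hσr ▸ hr.1) (fun h' => ?_) (by rw [hσr, hry]) (by simp)
      rw [← hry, ← hσr, h', h0]
  refine ⟨fun x _ => (hsmooth x).contDiffWithinAt, hinvOn.bijOn hmaps hmaps',
    ⟨_, fun y hy => ?_, hinvOn⟩, fun x hx => ?_⟩
  · obtain ⟨r, hr, hry, hσr⟩ := hinv hy
    have hσy : ContDiffAt ℝ ∞ σ ‖y‖ := hry ▸ contDiffAt_leftInverse hψ (hd r).ne' hσ
    exact (contDiffAt_twist_of_linear (mul_pos hκ ha) hσlin hk0 hσy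
      (hh.contDiffAt.comp _ hσy).neg).contDiffWithinAt
  · by_cases hx0 : x = 0
    · rw [jac_eq_of_eventuallyEq_smul hx
        (twist_eventuallyEq_smul hlin hh0 (by simpa [hx0] using ha)), Matrix.det_diagonal]
      simpa using pow_pos hκ 2
    · rw [(jac_twist hx hx0 ((hsmooth x).differentiableAt (by simp))
        (hψ.differentiable (by simp) _).hasDerivAt
        (hh.differentiable (by simp) _).hasDerivAt).1]
      have hr : 0 < ‖x‖ := by simpa using hx0
      have := hmono hr
      rw [h0] at this
      exact mul_pos (div_pos this hr) (hd _)

theorem hasPolarForm_twist {ψ h : ℝ → ℝ} (h0 : ψ 0 = 0) : HasPolarForm (twist ψ h) ψ h := by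
  intro r hr θ
  have hn : ‖(!₂[r * Real.cos θ, r * Real.sin θ] : Plane)‖ = r := by
    rw [← sq_eq_sq₀ (norm_nonneg _) hr.1, norm_sq_plane]
    simp only [Matrix.cons_val_zero, Matrix.cons_val_one]
    linear_combination r ^ 2 * Real.sin_sq_add_cos_sq θ
  rw [twist, hn, Real.cos_add, Real.sin_add]
  rcases hr.1.eq_or_lt with rfl | hr0
  · simp [h0]
  · ext i
    fin_cases i <;> simp <;> field_simp
    ring


/-! ### An explicit profile leaving r / 2 smoothly -/

open Polynomial in
theorem hasDerivAt_quadratic_mul_expNegInvGlue (c₀ c₁ c₂ x : ℝ) :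
    HasDerivAt (fun x => (c₀ + c₁ * x⁻¹ + c₂ * x⁻¹ ^ 2) * expNegInvGlue x)
      (x⁻¹ ^ 2 * ((c₀ + c₁ * x⁻¹ + c₂ * x⁻¹ ^ 2) - (c₁ + 2 * c₂ * x⁻¹)) * expNegInvGlue x) x := by
  convert expNegInvGlue.hasDerivAt_polynomial_eval_inv_mul (C c₀ + C c₁ * X + C c₂ * X ^ 2) x
    using 1
  · simp
  · simp
    ring_nf
    simp

/-- A radial profile that equals `r / 2` for `r ≤ a` and is strictly concave for `r > a`, with
the transition at `a` happening at scale `b`. -/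
noncomputable def baseProfile (a b r : ℝ) : ℝ :=
  r / 2 - b / 2 * (((r - a) / b + 1 / 2) * expNegInvGlue ((r - a) / b))

section baseProfile

variable {a b r : ℝ}

theorem baseProfile_of_le (hb : 0 < b) (hr : r ≤ a) : baseProfile a b r = r / 2 := by
  rw [baseProfile, expNegInvGlue.zero_of_nonpos (div_nonpos_of_nonpos_of_nonneg (by linarith) hb.le)]
  simp

theorem baseProfile_lt (hb : 0 < b) (hr : a < r) : baseProfile a b r < r / 2 := by
  have hx : 0 < (r - a) / b := div_pos (by linarith) hb
  have := expNegInvGlue.pos_of_pos hx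
  rw [baseProfile]
  have : 0 < b / 2 * (((r - a) / b + 1 / 2) * expNegInvGlue ((r - a) / b)) := by positivity
  linarith

theorem contDiff_baseProfile : ContDiff ℝ ∞ (baseProfile a b) := by
  have h : ContDiff ℝ ∞ fun r => expNegInvGlue ((r - a) / b) :=
    expNegInvGlue.contDiff.comp (by fun_prop)
  unfold baseProfile
  fun_prop

theorem hasDerivAt_baseProfile (hb : 0 < b) (r : ℝ) :
    HasDerivAt (baseProfile a b)
      (1 / 2 - 1 / 2 * ((1 + 1 * ((r - a) / b)⁻¹ + 1 / 2 * ((r - a) / b)⁻¹ ^ 2) *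
        expNegInvGlue ((r - a) / b))) r := by
  have hx : HasDerivAt (fun r => (r - a) / b) (1 / b) r :=
    ((hasDerivAt_id r).sub_const a).div_const b
  have hE : HasDerivAt expNegInvGlue (((r - a) / b)⁻¹ ^ 2 * expNegInvGlue ((r - a) / b))
      ((r - a) / b) := by
    have := hasDerivAt_quadratic_mul_expNegInvGlue 1 0 0 ((r - a) / b)
    simpa using this
  have h := ((hasDerivAt_id r).div_const 2).sub
    (((hx.add_const (1 / 2)).mul (hE.comp r hx)).const_mul (b / 2))
  refine (show HasDerivAt (baseProfile a b) _ r from h).congr_deriv ?_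
  simp only [Function.comp_apply]
  generalize expNegInvGlue ((r - a) / b) = E
  generalize (r - a) / b = x
  by_cases h0 : x = 0
  · subst h0; field_simp; simp
  · field_simp; ring

/-- For y = b/(r - a) > 0, the derivative of (1 + y + y²/2)e⁻ʸ in y collapses to -y²e⁻ʸ/2, so the
second derivative has one sign. -/
theorem hasDerivAt_deriv_baseProfile (hb : 0 < b) (r : ℝ) :
    HasDerivAt (deriv (baseProfile a b))
      (-(1 / (4 * b) * (((r - a) / b)⁻¹ ^ 4 * expNegInvGlue ((r - a) / b)))) r := by
  rw [funext fun r => (hasDerivAt_baseProfile (a := a) hb r).deriv]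
  have hx : HasDerivAt (fun r => (r - a) / b) (1 / b) r :=
    ((hasDerivAt_id r).sub_const a).div_const b
  have h := (((hasDerivAt_quadratic_mul_expNegInvGlue 1 1 (1 / 2) ((r - a) / b)).comp r
    hx).const_mul (1 / 2)).const_sub (1 / 2)
  refine h.congr_deriv ?_
  ring

/-- For r > a and y = b/(r - a), the bracket is the Taylor polynomial 1 + y + y²/2 of eʸ, hence less
than eʸ. The summand 1/2 in `baseProfile` is chosen to produce it. -/
theorem deriv_baseProfile_pos (hb : 0 < b) (r : ℝ) : 0 < deriv (baseProfile a b) r := by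
  rw [(hasDerivAt_baseProfile hb r).deriv]
  rcases le_or_gt ((r - a) / b) 0 with hx | hx
  · rw [expNegInvGlue.zero_of_nonpos hx]; norm_num
  · generalize (r - a) / b = x at *
    have hy : 0 < x⁻¹ := inv_pos.2 hx
    have h1 : 1 + 1 * x⁻¹ + 1 / 2 * x⁻¹ ^ 2 < Real.exp x⁻¹ := by
      have := Real.sum_le_exp_of_nonneg hy.le 4
      simp [Finset.sum_range_succ, Nat.factorial] at this
      have : 0 < x⁻¹ ^ 3 / 6 := by positivity
      simp only [inv_pow] at *
      linarith
    rw [expNegInvGlue, if_neg (not_le.2 hx), Real.exp_neg]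
    have := (mul_inv_lt_iff₀ (Real.exp_pos x⁻¹)).2 (h1.trans_eq (one_mul _).symm)
    linarith

theorem deriv_baseProfile_of_le (hb : 0 < b) (hr : r ≤ a) :
    deriv (baseProfile a b) r = 1 / 2 := by
  rw [(hasDerivAt_baseProfile hb r).deriv,
    expNegInvGlue.zero_of_nonpos (div_nonpos_of_nonpos_of_nonneg (by linarith) hb.le)]
  simp

theorem deriv_deriv_baseProfile_nonpos (hb : 0 < b) (r : ℝ) :
    deriv (deriv (baseProfile a b)) r ≤ 0 := by
  rw [(hasDerivAt_deriv_baseProfile hb r).deriv]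
  have := expNegInvGlue.nonneg ((r - a) / b)
  rw [neg_nonpos]
  positivity

theorem deriv_deriv_baseProfile_neg (hb : 0 < b) (hr : a < r) :
    deriv (deriv (baseProfile a b)) r < 0 := by
  rw [(hasDerivAt_deriv_baseProfile hb r).deriv]
  have hx : 0 < (r - a) / b := div_pos (by linarith) hb
  have := expNegInvGlue.pos_of_pos hx
  rw [neg_lt_zero]
  positivity

end baseProfile

theorem exists_baseProfile_one_eq {lam : ℝ} (h0 : 0 < lam) (h1 : lam < 1 / 2) :
    ∃ a b : ℝ, 0 < a ∧ a < 1 ∧ 0 < b ∧ baseProfile a b 1 = lam := by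
  have he := Real.add_one_le_exp (-(2 * lam))
  have hD : 1 - 2 * lam < (1 + lam) * Real.exp (-(2 * lam)) := by nlinarith
  set u := (1 - 2 * lam) / ((1 + lam) * Real.exp (-(2 * lam))) with hu
  have hD0 : 0 < (1 + lam) * Real.exp (-(2 * lam)) := by linarith
  have hu0 : 0 < u := div_pos (by linarith) hD0
  have hu1 : u < 1 := (div_lt_one hD0).2 hD
  have hum : u * ((1 + lam) * Real.exp (-(2 * lam))) = 1 - 2 * lam := div_mul_cancel₀ _ hD0.ne'
  -- Taking b proportional to 1 - a = u fixes (1 - a)/b = 1/(2λ), so the condition at r = 1 is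
  -- linear in u; `hD` says that its solution is below 1.
  refine ⟨1 - u, 2 * lam * u, by linarith, by linarith, by positivity, ?_⟩
  have hx : (1 - (1 - u)) / (2 * lam * u) = (2 * lam)⁻¹ := by field_simp; ring
  rw [baseProfile, hx, expNegInvGlue, if_neg (by rw [not_le]; positivity), inv_inv]
  have : 2 * lam * u / 2 * (((2 * lam)⁻¹ + 1 / 2) * Real.exp (-(2 * lam))) =
      u * ((1 + lam) * Real.exp (-(2 * lam))) / 2 := by field_simp
  rw [this, hum]
  ring

/-! ### The convex family of profiles -/

/-- Smooth concave increasing profiles that agree with `baseProfile a b` up to `c` and at `1`. -/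
structure IsAdmissible (a b c : ℝ) (ψ : ℝ → ℝ) : Prop where
  contDiff : ContDiff ℝ ∞ ψ
  eq_of_le : ∀ r ≤ c, ψ r = baseProfile a b r
  map_one : ψ 1 = baseProfile a b 1
  concave : ConcaveOn ℝ univ ψ
  deriv_pos : ∀ r, 0 < deriv ψ r

theorem convex_isAdmissible (a b c : ℝ) : Convex ℝ {ψ | IsAdmissible a b c ψ} := by
  intro ψ hψ χ hχ s t hs ht hst
  refine ⟨(hψ.contDiff.const_smul s).add (hχ.contDiff.const_smul t), fun r hr => ?_, ?_,
    (hψ.concave.smul hs).add (hχ.concave.smul ht), fun r => ?_⟩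
  · simp [hψ.eq_of_le r hr, hχ.eq_of_le r hr, ← add_mul, hst]
  · simp [hψ.map_one, hχ.map_one, ← add_mul, hst]
  · have h1 := (hψ.contDiff.differentiable (by simp) r).hasDerivAt
    have h2 := (hχ.contDiff.differentiable (by simp) r).hasDerivAt
    rw [((h1.const_smul s).add (h2.const_smul t)).deriv, smul_eq_mul, smul_eq_mul]
    have h3 := hψ.deriv_pos r
    have h4 := hχ.deriv_pos r
    rcases hs.eq_or_lt with rfl | hs'
    · have : t = 1 := by linarith
      subst this; linarith
    · have := mul_pos hs' h3
      have := mul_nonneg ht h4.le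
      linarith

/-- On the compact interval [c, 1] the first derivative of the base profile is bounded away from 0
above and the second is bounded away from 0 below, so a small multiple of η preserves both signs.
Off [c, 1] the derivatives are unchanged. -/
theorem exists_isAdmissible_add {a b c : ℝ} (hb : 0 < b) (hac : a < c) {η : ℝ → ℝ}
    (hη : ContDiff ℝ ∞ η) (hη0 : ∀ r ∉ Ioo c 1, η r = 0) :
    ∃ δ : ℝ, 0 < δ ∧ IsAdmissible a b c (baseProfile a b + δ • η) := by
  have hbp := contDiff_baseProfile (a := a) (b := b)
  have hη1 := (contDiff_infty_iff_deriv.1 hη).2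
  have hη2 := (contDiff_infty_iff_deriv.1 hη1).2
  have hb1 := (contDiff_infty_iff_deriv.1 hbp).2
  have hb2 := (contDiff_infty_iff_deriv.1 hb1).2
  have hz : ∀ r ∉ Icc c 1, deriv η r = 0 ∧ deriv (deriv η) r = 0 := by
    intro r hr
    have h1 : η =ᶠ[nhds r] fun _ => 0 := by
      filter_upwards [isClosed_Icc.isOpen_compl.mem_nhds hr] with s hs
      exact hη0 s fun h => hs (Ioo_subset_Icc_self h)
    exact ⟨by simp [h1.deriv_eq], by rw [h1.deriv.deriv_eq]; simp⟩
  obtain ⟨δ, hδ, hδ1⟩ : ∃ δ : ℝ, 0 < δ ∧ ∀ r ∈ Icc c 1, 0 < deriv (baseProfile a b) r + δ * deriv η r ∧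
      deriv (deriv (baseProfile a b)) r + δ * deriv (deriv η) r ≤ 0 := by
    have key (f g : ℝ → ℝ) (hf : Continuous f) (hg : Continuous g)
        (hfp : ∀ r ∈ Icc c 1, 0 < f r) :
        ∃ δ : ℝ, 0 < δ ∧ ∀ ε ∈ Ioc 0 δ, ∀ r ∈ Icc c 1, 0 < f r + ε * g r := by
      obtain ⟨m, hm, hmf⟩ : ∃ m > 0, ∀ r ∈ Icc c 1, m ≤ f r := by
        rcases (Icc c 1).eq_empty_or_nonempty with h | h
        · exact ⟨1, one_pos, by simp [h]⟩
        · obtain ⟨r, hr, hmin⟩ := isCompact_Icc.exists_isMinOn h hf.continuousOn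
          exact ⟨f r, hfp r hr, hmin⟩
      obtain ⟨M, hM⟩ := isCompact_Icc.exists_bound_of_continuousOn (s := Icc c 1) hg.continuousOn
      have hM' : 0 < |M| + 1 := by positivity
      refine ⟨m / (|M| + 1), div_pos hm hM', fun ε hε r hr => ?_⟩
      have h1 := hmf r hr
      have h2 : -(|M|) ≤ g r := by
        have := neg_abs_le (g r)
        have := (hM r hr).trans (le_abs_self M)
        rw [Real.norm_eq_abs] at this
        linarith
      have h3 : ε * (|M| + 1) ≤ m := (le_div_iff₀ hM').1 hε.2
      nlinarith [hε.1, mul_le_mul_of_nonneg_left h2 hε.1.le]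
    obtain ⟨δ₁, h1, h1'⟩ := key _ _ hb1.continuous hη1.continuous
      fun r _ => deriv_baseProfile_pos hb r
    obtain ⟨δ₂, h2, h2'⟩ := key _ _ hb2.continuous.neg hη2.continuous.neg
      fun r hr => neg_pos.2 (deriv_deriv_baseProfile_neg hb (hac.trans_le hr.1))
    refine ⟨min δ₁ δ₂, lt_min h1 h2, fun r hr =>
      ⟨h1' _ ⟨lt_min h1 h2, min_le_left _ _⟩ r hr, ?_⟩⟩
    have := h2' _ ⟨lt_min h1 h2, min_le_right _ _⟩ r hr
    simp only [Pi.neg_apply] at this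
    linarith
  have hd (r : ℝ) : HasDerivAt (baseProfile a b + δ • η)
      (deriv (baseProfile a b) r + δ * deriv η r) r :=
    (hbp.differentiable (by simp) r).hasDerivAt.add
      ((hη.differentiable (by simp) r).hasDerivAt.const_smul δ)
  have hd2 (r : ℝ) : HasDerivAt (deriv (baseProfile a b + δ • η))
      (deriv (deriv (baseProfile a b)) r + δ * deriv (deriv η) r) r := by
    rw [funext fun r => (hd r).deriv]
    exact (hb1.differentiable (by simp) r).hasDerivAt.add
      ((hη1.differentiable (by simp) r).hasDerivAt.const_mul δ)
  refine ⟨δ, hδ, hbp.add (hη.const_smul δ), fun r hr => ?_, ?_,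
    concaveOn_univ_of_deriv2_nonpos (fun r => (hd r).differentiableAt)
      (fun r => (hd2 r).differentiableAt) fun r => ?_, fun r => ?_⟩
  · simp [hη0 r fun h => hr.not_gt h.1]
  · simp [hη0 1 fun h => lt_irrefl _ h.2]
  · change deriv (deriv _) r ≤ 0
    rw [(hd2 r).deriv]
    by_cases hr : r ∈ Icc c 1
    · exact (hδ1 r hr).2
    · rw [(hz r hr).2, mul_zero, add_zero]
      exact deriv_deriv_baseProfile_nonpos hb r
  · rw [(hd r).deriv]
    by_cases hr : r ∈ Icc c 1
    · exact (hδ1 r hr).1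
    · rw [(hz r hr).1, mul_zero, add_zero]
      exact deriv_baseProfile_pos hb r

theorem isAdmissible_baseProfile {a b c : ℝ} (hb : 0 < b) (hac : a < c) :
    IsAdmissible a b c (baseProfile a b) := by
  obtain ⟨δ, -, h⟩ := exists_isAdmissible_add (η := 0) hb hac contDiff_const (by simp)
  simpa using h

open Polynomial in
theorem infiniteDimensionalOnIcc_isAdmissible {a b c : ℝ} (hb : 0 < b) (hac : a < c) (hc0 : 0 ≤ c)
    (hc1 : c < 1) : InfiniteDimensionalOnIcc {ψ | IsAdmissible a b c ψ} := by
  intro hfin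
  set V := vectorSpan ℝ ((Icc (0 : ℝ) 1).domRestrict '' {ψ | IsAdmissible a b c ψ})
  let β : ℝ → ℝ := fun r => expNegInvGlue (r - c) * expNegInvGlue (1 - r)
  have hβ : ContDiff ℝ ∞ β :=
    (expNegInvGlue.contDiff.comp (by fun_prop)).mul (expNegInvGlue.contDiff.comp (by fun_prop))
  -- Polynomials times a fixed bump, positive on (c, 1), embed ℝ[X] into the span of differences:
  -- each product is δ⁻¹ times a difference of admissible profiles.
  let T : ℝ[X] →ₗ[ℝ] (Icc (0 : ℝ) 1 → ℝ) :=
    { toFun := fun q r => q.eval (r : ℝ) * β r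
      map_add' := fun p q => by ext r; simp [add_mul]
      map_smul' := fun s q => by ext r; simp [mul_assoc] }
  have hT (q : ℝ[X]) : T q ∈ V := by
    obtain ⟨δ, hδ, h⟩ := exists_isAdmissible_add (a := a) (η := fun r => q.eval r * β r) hb hac
      ((q.contDiff_aeval (𝕜 := ℝ) ∞).mul hβ) fun r hr => by
        rcases le_or_gt r c with h | h
        · simp [β, expNegInvGlue.zero_of_nonpos (sub_nonpos.2 h)]
        · have : 1 ≤ r := by by_contra h'; exact hr ⟨h, not_le.1 h'⟩
          simp [β, expNegInvGlue.zero_of_nonpos (sub_nonpos.2 this)]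
    have h1 := vsub_mem_vectorSpan ℝ (mem_image_of_mem ((Icc (0 : ℝ) 1).domRestrict) h)
      (mem_image_of_mem ((Icc (0 : ℝ) 1).domRestrict) (isAdmissible_baseProfile hb hac))
    have h2 := V.smul_mem δ⁻¹ h1
    convert h2 using 1
    ext r
    simp [T, hδ.ne']
  have hinj : Function.Injective (T.codRestrict V hT) := by
    rw [← LinearMap.ker_eq_bot, LinearMap.ker_codRestrict, LinearMap.ker_eq_bot']
    intro q hq
    refine Polynomial.eq_zero_of_infinite_isRoot q ((Ioo_infinite hc1).mono fun r hr => ?_)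
    have h1 := congrFun hq ⟨r, hc0.trans hr.1.le, hr.2.le⟩
    have h2 : 0 < β r := mul_pos (expNegInvGlue.pos_of_pos (sub_pos.2 hr.1))
      (expNegInvGlue.pos_of_pos (sub_pos.2 hr.2))
    simpa [T, h2.ne'] using h1
  exact Polynomial.not_finite (R := ℝ) (Module.Finite.of_injective _ hinj)


/-! ### Solving for the twist angle and its smoothness -/

theorem expNegInvGlue_two_mul_sq (x : ℝ) : expNegInvGlue (2 * x) ^ 2 = expNegInvGlue x := by
  rcases le_or_gt x 0 with hx | hx
  · simp [expNegInvGlue.zero_of_nonpos hx, expNegInvGlue.zero_of_nonpos (by linarith : 2 * x ≤ 0)]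
  · rw [expNegInvGlue, expNegInvGlue, if_neg (by linarith), if_neg (by linarith), ← Real.exp_nat_mul]
    congr 1
    field_simp
    simp

/-- The amount by which the planar divergence of the profile `ψ` falls short of `1`. -/
noncomputable def defect (ψ : ℝ → ℝ) (r : ℝ) : ℝ := 1 - deriv ψ r - ψ r / r

/-- The derivative of the twist for which the differential equation `SolvesODE` holds. -/
noncomputable def twistRate (ψ : ℝ → ℝ) (r : ℝ) : ℝ :=
  Real.sqrt (defect ψ r * (2 - defect ψ r)) / ψ r

/-- The twist that solves `SolvesODE` for the profile `ψ` and vanishes at `0`. -/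
noncomputable def twistAngle (ψ : ℝ → ℝ) (r : ℝ) : ℝ := ∫ s in (0 : ℝ)..r, twistRate ψ s

theorem hasDerivAt_twistAngle {ψ : ℝ → ℝ} (h : Continuous (twistRate ψ)) (r : ℝ) :
    HasDerivAt (twistAngle ψ) (twistRate ψ r) r :=
  intervalIntegral.integral_hasDerivAt_right (h.intervalIntegrable _ _)
    (h.stronglyMeasurableAtFilter _ _) h.continuousAt

namespace IsAdmissible

variable {a b c r : ℝ} {ψ : ℝ → ℝ}

theorem differentiable (h : IsAdmissible a b c ψ) : Differentiable ℝ ψ :=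
  h.contDiff.differentiable (by simp)

theorem strictMono (h : IsAdmissible a b c ψ) : StrictMono ψ := strictMono_of_deriv_pos h.deriv_pos

theorem eq_half (h : IsAdmissible a b c ψ) (hb : 0 < b) (hac : a < c) (hr : r ≤ a) :
    ψ r = r / 2 := by
  rw [h.eq_of_le r (hr.trans hac.le), baseProfile_of_le hb hr]

theorem map_zero (h : IsAdmissible a b c ψ) (hb : 0 < b) (ha : 0 < a) (hac : a < c) : ψ 0 = 0 := by
  simp [h.eq_half hb hac ha.le]

theorem pos (h : IsAdmissible a b c ψ) (hb : 0 < b) (ha : 0 < a) (hac : a < c) (hr : 0 < r) :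
    0 < ψ r := h.map_zero hb ha hac ▸ h.strictMono hr

theorem deriv_eq (h : IsAdmissible a b c ψ) (hr : r < c) :
    deriv ψ r = deriv (baseProfile a b) r := by
  refine Filter.EventuallyEq.deriv_eq ?_
  filter_upwards [Iio_mem_nhds hr] with s hs
  exact h.eq_of_le s (le_of_lt hs)

theorem lt_half (h : IsAdmissible a b c ψ) (hb : 0 < b) (ha : 0 < a) (hac : a < c) (hr : a < r) :
    ψ r < r / 2 := by
  rcases le_or_gt r c with hrc | hrc
  · rw [h.eq_of_le r hrc]; exact baseProfile_lt hb hr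
  -- Beyond c, concavity bounds the slope from c to r by the chord slope ψ c / c < 1/2.
  · have hc := baseProfile_lt hb hac
    rw [← h.eq_of_le c le_rfl] at hc
    have h1 := h.concave.slope_anti_adjacent (mem_univ 0) (mem_univ r) (ha.trans hac) hrc
    rw [h.map_zero hb ha hac, sub_zero, sub_zero] at h1
    have h2 : ψ c / c < 1 / 2 := by rw [div_lt_iff₀ (ha.trans hac)]; linarith
    have h3 := h1.trans_lt h2
    rw [div_lt_iff₀ (by linarith)] at h3
    linarith

theorem deriv_le (h : IsAdmissible a b c ψ) (hb : 0 < b) (ha : 0 < a) (hac : a < c) (hr : 0 < r) :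
    deriv ψ r ≤ ψ r / r := by
  have := h.concave.deriv_le_slope (mem_univ 0) (mem_univ r) hr (h.differentiable r)
  rwa [slope_def_field, h.map_zero hb ha hac, sub_zero, sub_zero] at this

theorem defect_eq_zero (h : IsAdmissible a b c ψ) (hb : 0 < b) (hac : a < c) (hr : r ≤ a)
    (hr0 : r ≠ 0) : defect ψ r = 0 := by
  rw [defect, h.deriv_eq (hr.trans_lt hac), deriv_baseProfile_of_le hb hr, h.eq_half hb hac hr]
  field_simp
  norm_num

theorem defect_pos (h : IsAdmissible a b c ψ) (hb : 0 < b) (ha : 0 < a) (hac : a < c)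
    (hr : a < r) : 0 < defect ψ r := by
  have h1 := h.deriv_le hb ha hac (ha.trans hr)
  have h2 : ψ r / r < 1 / 2 := by
    rw [div_lt_iff₀ (ha.trans hr)]; linarith [h.lt_half hb ha hac hr]
  rw [defect]; linarith

theorem defect_nonneg (h : IsAdmissible a b c ψ) (hb : 0 < b) (ha : 0 < a) (hac : a < c)
    (hr : 0 < r) : 0 ≤ defect ψ r := by
  rcases le_or_gt r a with h1 | h1
  · rw [h.defect_eq_zero hb hac h1 hr.ne']
  · exact (h.defect_pos hb ha hac h1).le

theorem two_sub_defect_pos (h : IsAdmissible a b c ψ) (hb : 0 < b) (ha : 0 < a) (hac : a < c)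
    (hr : 0 < r) : 0 < 2 - defect ψ r := by
  have h1 := div_pos (h.pos hb ha hac hr) hr
  have h2 := h.deriv_pos r
  rw [defect]; linarith

theorem twistRate_eq_zero (h : IsAdmissible a b c ψ) (hb : 0 < b) (ha : 0 < a) (hac : a < c)
    (hr : r ≤ a) : twistRate ψ r = 0 := by
  rw [twistRate]
  -- At r = 0 the defect takes the spurious value 1/2, because ψ 0 / 0 = 0; the rate still vanishes
  -- there, by division by ψ 0 = 0.
  by_cases h0 : r = 0
  · rw [h0, h.map_zero hb ha hac, div_zero]
  · rw [h.defect_eq_zero hb hac hr h0]; simp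

theorem twistRate_nonneg (h : IsAdmissible a b c ψ) (hb : 0 < b) (ha : 0 < a) (hac : a < c)
    (r : ℝ) : 0 ≤ twistRate ψ r := by
  rcases le_or_gt r a with h1 | h1
  · rw [h.twistRate_eq_zero hb ha hac h1]
  · exact div_nonneg (Real.sqrt_nonneg _) (h.pos hb ha hac (ha.trans h1)).le

theorem twistRate_ode (h : IsAdmissible a b c ψ) (hb : 0 < b) (ha : 0 < a) (hac : a < c)
    (hr : 0 < r) : (deriv ψ r + ψ r / r) ^ 2 + (twistRate ψ r * ψ r) ^ 2 = 1 := by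
  rw [twistRate, div_mul_cancel₀ _ (h.pos hb ha hac hr).ne', Real.sq_sqrt
    (mul_nonneg (h.defect_nonneg hb ha hac hr) (h.two_sub_defect_pos hb ha hac hr).le), defect]
  ring

theorem contDiffAt_defect (h : IsAdmissible a b c ψ) (hr : r ≠ 0) :
    ContDiffAt ℝ ∞ (defect ψ) r :=
  (contDiffAt_const.sub (contDiff_infty_iff_deriv.1 h.contDiff).2.contDiffAt).sub
    (h.contDiff.contDiffAt.div contDiffAt_id hr)

/-- The defect is a square times a factor equal to 1/4 at r = a, since e^(-1/x) is the square of
e^(-1/(2x)). This makes its square root smooth across a. -/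
theorem defect_eq_of_lt (h : IsAdmissible a b c ψ) (hb : 0 < b) (hr : r < c) (hr0 : r ≠ 0) :
    defect ψ r = (((r - a) / b)⁻¹ * expNegInvGlue (2 * ((r - a) / b))) ^ 2 *
      (1 / 2 * (((r - a) / b) ^ 2 + (r - a) / b + 1 / 2 +
        ((r - a) / b) ^ 2 * ((r - a) / b + 1 / 2) * b / r)) := by
  rw [defect, h.deriv_eq hr, (hasDerivAt_baseProfile hb r).deriv, h.eq_of_le r hr.le, baseProfile,
    mul_pow, expNegInvGlue_two_mul_sq]
  by_cases hx : (r - a) / b = 0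
  · simp only [hx, expNegInvGlue.zero]
    field_simp
    norm_num
  · generalize expNegInvGlue ((r - a) / b) = E
    generalize (r - a) / b = x at *
    field_simp
    ring

theorem contDiffAt_twistRate_self (h : IsAdmissible a b c ψ) (hb : 0 < b) (ha : 0 < a)
    (hac : a < c) : ContDiffAt ℝ ∞ (twistRate ψ) a := by
  let q : ℝ → ℝ := fun r => ((r - a) / b)⁻¹ * expNegInvGlue (2 * ((r - a) / b))
  let B : ℝ → ℝ := fun r => 1 / 2 * (((r - a) / b) ^ 2 + (r - a) / b + 1 / 2 +
        ((r - a) / b) ^ 2 * ((r - a) / b + 1 / 2) * b / r)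
  have hq : ContDiff ℝ ∞ q := by
    have h1 : ContDiff ℝ ∞ fun x : ℝ => 2 * (x⁻¹ * expNegInvGlue x) := by
      have := expNegInvGlue.contDiff_polynomial_eval_inv_mul (n := ⊤) Polynomial.X
      simp only [Polynomial.eval_X] at this
      exact contDiff_const.mul this
    have h2 : ContDiff ℝ ∞ fun r : ℝ => 2 * ((r - a) / b) := by fun_prop
    have h3 : q = (fun x : ℝ => 2 * (x⁻¹ * expNegInvGlue x)) ∘ fun r => 2 * ((r - a) / b) := by
      ext r
      simp only [q, Function.comp_apply, mul_inv]
      ring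
    rw [h3]
    exact h1.comp h2
  have hB : ContDiffAt ℝ ∞ B a := by
    have h1 : ContDiff ℝ ∞ fun r : ℝ => (r - a) / b := by fun_prop
    exact contDiffAt_const.mul ((((h1.pow 2).add h1).add contDiff_const).contDiffAt.add
      ((((h1.pow 2).mul (h1.add contDiff_const)).mul contDiff_const).contDiffAt.div
        contDiffAt_id ha.ne'))
  have hS : ContDiffAt ℝ ∞ (fun r => q r * Real.sqrt (B r * (2 - defect ψ r)) / ψ r) a := by
    refine (hq.contDiffAt.mul ((hB.mul (contDiffAt_const.sub (h.contDiffAt_defect ha.ne'))).sqrt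
      ?_)).div h.contDiff.contDiffAt (h.pos hb ha hac ha).ne'
    rw [h.defect_eq_zero hb hac le_rfl ha.ne']
    simp [B]
  refine hS.congr_of_eventuallyEq ?_
  filter_upwards [Iio_mem_nhds hac, Ioi_mem_nhds ha] with r hrc hr0
  -- Nonnegativity of q gives √(q²) = q rather than |q|.
  have hq0 : 0 ≤ q r := by
    rcases le_or_gt ((r - a) / b) 0 with hx | hx
    · simp [q, expNegInvGlue.zero_of_nonpos (by linarith : 2 * ((r - a) / b) ≤ 0)]
    · exact mul_nonneg (inv_nonneg.2 hx.le) (expNegInvGlue.nonneg _)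
  have hd : defect ψ r = q r ^ 2 * B r := h.defect_eq_of_lt hb hrc (ne_of_gt hr0)
  have : defect ψ r * (2 - defect ψ r) = q r ^ 2 * (B r * (2 - defect ψ r)) := by
    nth_rewrite 1 [hd]; ring
  rw [twistRate, this, Real.sqrt_mul (sq_nonneg _), Real.sqrt_sq hq0]

theorem contDiff_twistRate (h : IsAdmissible a b c ψ) (hb : 0 < b) (ha : 0 < a) (hac : a < c) :
    ContDiff ℝ ∞ (twistRate ψ) := by
  rw [contDiff_iff_contDiffAt]
  intro r
  rcases lt_trichotomy r a with hr | rfl | hr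
  · refine (contDiffAt_const (c := (0 : ℝ))).congr_of_eventuallyEq ?_
    filter_upwards [Iio_mem_nhds hr] with s hs
    exact h.twistRate_eq_zero hb ha hac (le_of_lt hs)
  · exact h.contDiffAt_twistRate_self hb ha hac
  · have hr0 := ha.trans hr
    have hd := h.contDiffAt_defect hr0.ne'
    exact ((hd.mul (contDiffAt_const.sub hd)).sqrt (mul_pos (h.defect_pos hb ha hac hr)
      (h.two_sub_defect_pos hb ha hac hr0)).ne').div h.contDiff.contDiffAt
        (h.pos hb ha hac hr0).ne'

theorem contDiff_twistAngle (h : IsAdmissible a b c ψ) (hb : 0 < b) (ha : 0 < a) (hac : a < c) :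
    ContDiff ℝ ∞ (twistAngle ψ) := by
  have hw := h.contDiff_twistRate hb ha hac
  rw [contDiff_infty_iff_deriv, funext fun r => (hasDerivAt_twistAngle hw.continuous r).deriv]
  exact ⟨fun r => (hasDerivAt_twistAngle hw.continuous r).differentiableAt, hw⟩

theorem monotone_twistAngle (h : IsAdmissible a b c ψ) (hb : 0 < b) (ha : 0 < a) (hac : a < c) :
    Monotone (twistAngle ψ) := by
  have hw := (h.contDiff_twistRate hb ha hac).continuous
  refine monotone_of_deriv_nonneg
    (fun r => (hasDerivAt_twistAngle hw r).differentiableAt) fun r => ?_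
  rw [(hasDerivAt_twistAngle hw r).deriv]
  exact h.twistRate_nonneg hb ha hac r

theorem twistAngle_eq_zero (h : IsAdmissible a b c ψ) (hb : 0 < b) (ha : 0 < a) (hac : a < c)
    (hr : r ≤ a) : twistAngle ψ r = 0 := by
  refine intervalIntegral.integral_zero_ae (Filter.Eventually.of_forall fun s hs => ?_)
  exact h.twistRate_eq_zero hb ha hac (hs.2.trans (max_le ha.le hr))

theorem isProfile (h : IsAdmissible a b c ψ) (hb : 0 < b) (ha : 0 < a) (ha1 : a < 1)
    (hac : a < c) : IsProfile (baseProfile a b 1) ψ where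
  smooth := h.contDiff.contDiffOn
  concave := h.concave.subset (subset_univ _) (convex_Icc 0 1)
  strictMono := h.strictMono.strictMonoOn _
  map_zero := h.map_zero hb ha hac
  map_one := h.map_one
  linear_near_zero := ⟨a, ⟨ha, ha1.le⟩, fun _ hr => h.eq_half hb hac hr.2⟩

theorem solvesODE (h : IsAdmissible a b c ψ) (hb : 0 < b) (ha : 0 < a) (hac : a < c) :
    SolvesODE ψ (twistAngle ψ) := by
  intro r hr
  have hu := uniqueDiffOn_Icc zero_lt_one r (Ioc_subset_Icc_self hr)
  have hw := (h.contDiff_twistRate hb ha hac).continuous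
  rw [(h.differentiable r).derivWithin hu,
    (hasDerivAt_twistAngle hw r).hasDerivWithinAt.derivWithin hu]
  exact h.twistRate_ode hb ha hac hr.1

theorem twist_mem_diff (h : IsAdmissible a b c ψ) (hb : 0 < b) (ha : 0 < a) (hac : a < c) :
    twist ψ (twistAngle ψ) ∈ Diff (disk 1) (disk (baseProfile a b 1)) := by
  rw [← h.map_one]
  exact DiskMap.twist_mem_diff (κ := 1 / 2) ha (by norm_num) h.contDiff
    (h.contDiff_twistAngle hb ha hac) h.deriv_pos
    (fun r hr => by rw [h.eq_half hb hac hr.le]; ring)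
    fun r hr => h.twistAngle_eq_zero hb ha hac hr.le

theorem energy_twist (h : IsAdmissible a b c ψ) (hb : 0 < b) (ha : 0 < a) (hac : a < c) :
    energy (disk 1) (twist ψ (twistAngle ψ)) = 1 - 2 * baseProfile a b 1 ^ 2 := by
  have hψ1 : 0 ≤ baseProfile a b 1 := h.map_one ▸ (h.pos hb ha hac one_pos).le
  have hangle := h.contDiff_twistAngle hb ha hac
  have hlin : ∀ r < a, ψ r = 1 / 2 * r := fun r hr => by rw [h.eq_half hb hac hr.le]; ring
  have hzero : ∀ r < a, twistAngle ψ r = 0 := fun r hr => h.twistAngle_eq_zero hb ha hac hr.le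
  refine energy_eq_of_conformalPart_eq_one hψ1 (h.twist_mem_diff hb ha hac) fun x hx => ?_
  by_cases hx0 : x = 0
  · rw [jac_eq_of_eventuallyEq_smul hx
      (twist_eventuallyEq_smul hlin hzero (by simpa [hx0] using ha))]
    simp [conformalPart]
    norm_num
  · have hd : DifferentiableAt ℝ (twist ψ (twistAngle ψ)) x :=
      (contDiffAt_twist hx0 h.contDiff.contDiffAt hangle.contDiffAt).differentiableAt (by simp)
    rw [(jac_twist hx hx0 hd (h.differentiable _).hasDerivAt
      (hasDerivAt_twistAngle (h.contDiff_twistRate hb ha hac).continuous _)).2,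
      h.twistRate_ode hb ha hac (by simpa using hx0), Real.sqrt_one]

end IsAdmissible

end DiskMap

theorem proposition1p5 (lam : ℝ) (hlam_pos : 0 < lam) (hlam_lt : lam < 1 / 2) :
    IsLeast (DiskMap.energy (DiskMap.disk 1) '' DiskMap.Diff (DiskMap.disk 1) (DiskMap.disk lam))
        (DiskMap.F (lam ^ 2)) ∧
      ∃ C : Set (ℝ → ℝ), Convex ℝ C ∧ DiskMap.InfiniteDimensionalOnIcc C ∧
        ∀ ψ ∈ C, DiskMap.IsProfile lam ψ ∧
          ∃ h : ℝ → ℝ, ContDiffOn ℝ ∞ h (Set.Icc 0 1) ∧ h 0 = 0 ∧ MonotoneOn h (Set.Icc 0 1) ∧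
            DiskMap.SolvesODE ψ h ∧
            ∃ φ ∈ DiskMap.Diff (DiskMap.disk 1) (DiskMap.disk lam),
              DiskMap.HasPolarForm φ ψ h ∧
              DiskMap.energy (DiskMap.disk 1) φ = DiskMap.F (lam ^ 2) := by
  have hF : DiskMap.F (lam ^ 2) = 1 - 2 * lam ^ 2 := by
    rw [DiskMap.F, if_pos (by nlinarith)]
  obtain ⟨a, b, ha, ha1, hb, rfl⟩ := DiskMap.exists_baseProfile_one_eq hlam_pos hlam_lt
  obtain ⟨c, hac, hc1⟩ := exists_between ha1
  rw [hF]
  refine ⟨⟨?_, ?_⟩, {ψ | DiskMap.IsAdmissible a b c ψ}, DiskMap.convex_isAdmissible a b c,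
    DiskMap.infiniteDimensionalOnIcc_isAdmissible hb hac (ha.trans hac).le hc1, fun ψ hψ => ?_⟩
  · have h := DiskMap.isAdmissible_baseProfile hb hac
    exact ⟨_, h.twist_mem_diff hb ha hac, h.energy_twist hb ha hac⟩
  · rintro _ ⟨φ, hφ, rfl⟩
    exact DiskMap.energy_ge hlam_pos.le hφ
  · exact ⟨hψ.isProfile hb ha ha1 hac, DiskMap.twistAngle ψ,
      (hψ.contDiff_twistAngle hb ha hac).contDiffOn, hψ.twistAngle_eq_zero hb ha hac ha.le,
      (hψ.monotone_twistAngle hb ha hac).monotoneOn _, hψ.solvesODE hb ha hac, _,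
      hψ.twist_mem_diff hb ha hac,
      DiskMap.hasPolarForm_twist (hψ.map_zero hb ha hac), hψ.energy_twist hb ha hac⟩
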